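/- Let $I$ be an infinite set and $(A_i)_{i\in I}$ a family of unital $C^*$-algebras. *The algebra.* Let $\bigotimes_{i\in I}A_i$ be the algebraic tensor product that is universal for multilinear maps on $\prod_{i\in I}A_i$; it is a unital $^*$-algebra with $(\otimes_i a_i)(\otimes_i b_i)=\otimes_i a_ib_i$ and $(\otimes_i a_i)^*=\otimes_i a_i^*$. Let $\bigotimes^{\rm ut}_{i\in I}A_i$ be the $^*$-subalgebra spanned by all $\otimes_i a_i$ for which there is a family of unitaries $u_i\in A_i$ with $a_i=u_i$ for all but finitely many $i$. *The Hilbert space.* For Hilbert spaces $(H_i)_{i\in I}$ let $\bigotimes^{\rm un}_{i\in I}H_i\subseteq\bigotimes_{i\in I}H_i$ be the span of all $\otimes_i x_i$ with $\|x_i\|=1$ for every $i$. It carries the inner product determined by $\langle\otimes_i x_i,\otimes_i y_i\rangle=\prod_i\langle x_i,y_i\rangle$ if $\langle x_i,y_i\rangle=1$ for all but finitely many $i$, and $=0$ otherwise. Let $\bar\bigotimes^{\phi_1}_{i\in I}H_i$ be its completion. For unital $^*$-representations $\Psi_i:A_i\to\mathcal L(H_i)$ let $\bigotimes^{\phi_1}_{i\in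 I}\Psi_i:\bigotimes^{\rm ut}_{i\in I}A_i\to\mathcal L(\bar\bigotimes^{\phi_1}_{i\in I}H_i)$ be the $^*$-representation determined by $(\otimes_i a_i)(\otimes_i x_i)=\otimes_i\Psi_i(a_i)x_i$. *The representations.* Let $S(A_i)$ be the state space of $A_i$, and let $(H_{\rho_i},\pi_{\rho_i},\xi_{\rho_i})$ be the GNS construction of $\rho_i\in S(A_i)$. For $\rho=(\rho_i)_i\in\prod_{i\in I}S(A_i)$ let $H_{\check\rho}\subseteq\bar\bigotimes^{\phi_1}_{i\in I}H_{\rho_i}$ be the closed linear span of all $\otimes_i x_i$ for which there is a family of unitaries $u_i\in A_i$ with $x_i=\pi_{\rho_i}(u_i)\xi_{\rho_i}$ for all but finitely many $i$. It is invariant under $\bigotimes^{\phi_1}_{i\in I}\pi_{\rho_i}$; let $\pi_{\check\rho}$ be the restriction of $\bigotimes^{\phi_1}_{i\in I}\pi_{\rho_i}$ to $H_{\check\rho}$. **Corollary.** The $^*$-representation $$\Psi_A:=\bigoplus_{\rho\in\prod_i S(A_i)}(H_{\check\rho},\pi_{\check\rho})$$ of $\bigotimes^{\rm ut}_{i\in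 I}A_i$ on the Hilbert space direct sum of the $H_{\check\rho}$ is injective. Consequently, the $^*$-representation $$\Phi_A:=\bigoplus_{\rho\in\prod_i S(A_i)}\Big(\bar\bigotimes^{\phi_1}_{i\in I}H_{\rho_i},\ \bigotimes^{\phi_1}_{i\in I}\pi_{\rho_i}\Big)$$ is injective as well. -/

import Mathlib

open scoped TensorProduct ComplexOrder InnerProductSpace
open Function

noncomputable section

namespace InfTensor

/-! ### Conjugate-linear maps out of an infinite tensor product -/

/-- The complex conjugate of a complex vector space: same additive group, with the scalar
action twisted by conjugation. -/
def ConjMod (E : Type*) := E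

instance (E : Type*) [AddCommGroup E] : AddCommGroup (ConjMod E) := inferInstanceAs (AddCommGroup E)

instance (E : Type*) [AddCommGroup E] [Module ℂ E] : Module ℂ (ConjMod E) :=
  Module.compHom E (starRingEnd ℂ)

/-- The conjugate-linear map on `⨂ X i` induced by a coordinatewise conjugate-linear map. -/
def conjLift {I : Type*} {X : I → Type*} [∀ i, AddCommGroup (X i)] [∀ i, Module ℂ (X i)]
    {E : Type*} [AddCommGroup E] [Module ℂ E] (f : (∀ i, X i) → E)
    (hadd : ∀ [DecidableEq I] (x : ∀ i, X i) (i : I) (a b : X i),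
      f (update x i (a + b)) = f (update x i a) + f (update x i b))
    (hsmul : ∀ [DecidableEq I] (x : ∀ i, X i) (i : I) (c : ℂ) (a : X i),
      f (update x i (c • a)) = (starRingEnd ℂ c) • f (update x i a)) :
    (⨂[ℂ] i, X i) →ₗ⋆[ℂ] E :=
  let g : MultilinearMap ℂ X (ConjMod E) :=
    { toFun := f
      map_update_add' := fun x i a b => hadd x i a b
      map_update_smul' := fun x i c a => hsmul x i c a }
  { toFun := fun t => (PiTensorProduct.lift g t : ConjMod E)
    map_add' := fun s t => (PiTensorProduct.lift g).map_add s t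
    map_smul' := fun c t => (PiTensorProduct.lift g).map_smul c t }

/-- Two semilinear maps on `⨂ X i` that agree on elementary tensors are equal. -/
theorem semilin_ext {I : Type*} {X : I → Type*} [∀ i, AddCommGroup (X i)] [∀ i, Module ℂ (X i)]
    {E : Type*} [AddCommGroup E] [Module ℂ E] {σ : ℂ →+* ℂ} {f g : (⨂[ℂ] i, X i) →ₛₗ[σ] E}
    (h : ∀ x : ∀ i, X i, f (PiTensorProduct.tprod ℂ x) = g (PiTensorProduct.tprod ℂ x)) :
    f = g := by
  ext t
  induction t using PiTensorProduct.induction_on with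
  | smul_tprod r x => rw [map_smulₛₗ, map_smulₛₗ, h]
  | add s t hs ht => rw [map_add, map_add, hs, ht]

/-! ### The *-algebra `⨂ A i` and its *-subalgebra `⨂^ut A i` -/

section StarAlgebra

variable {I : Type*} {A : I → Type*} [∀ i, Ring (A i)] [∀ i, StarRing (A i)]
  [∀ i, Algebra ℂ (A i)] [∀ i, StarModule ℂ (A i)]

/-- The involution of `⨂ A i`, determined by `(⨂ aᵢ)* = ⨂ aᵢ*`. -/
def starMap : (⨂[ℂ] i, A i) →ₗ⋆[ℂ] (⨂[ℂ] i, A i) :=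
  conjLift (fun a => PiTensorProduct.tprod ℂ (star a))
    (fun x i a b => by
      simp only [← Function.update_star, star_add, MultilinearMap.map_update_add])
    (fun x i c a => by
      simp only [← Function.update_star, star_smul, MultilinearMap.map_update_smul]; rfl)

@[simp] theorem starMap_tprod (a : ∀ i, A i) :
    starMap (PiTensorProduct.tprod ℂ a) = PiTensorProduct.tprod ℂ (star a) :=
  PiTensorProduct.lift.tprod (R := ℂ) (E := ConjMod (⨂[ℂ] i, A i)) a

instance instStarTensor : StarRing (⨂[ℂ] i, A i) where
  star := starMap
  star_involutive t := by
    have : (starMap.comp starMap : (⨂[ℂ] i, A i) →ₗ[ℂ] (⨂[ℂ] i, A i)) = LinearMap.id :=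
      semilin_ext (fun x => by simp)
    exact LinearMap.congr_fun this t
  star_mul s t := by
    change starMap (s * t) = starMap t * starMap s
    induction s using PiTensorProduct.induction_on with
    | smul_tprod r x =>
      induction t using PiTensorProduct.induction_on with
      | smul_tprod q y =>
        simp only [map_smulₛₗ, PiTensorProduct.smul_tprod_mul_smul_tprod, starMap_tprod, map_mul,
          star_mul]
        rw [mul_comm]
      | add t₁ t₂ h₁ h₂ => rw [mul_add, map_add, map_add, add_mul, h₁, h₂]
    | add s₁ s₂ h₁ h₂ => rw [add_mul, map_add, map_add, mul_add, h₁, h₂]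
  star_add s t := map_add starMap s t

theorem star_tprod (a : ∀ i, A i) :
    star (PiTensorProduct.tprod ℂ a) = PiTensorProduct.tprod ℂ (star a) :=
  starMap_tprod a

instance instStarModuleTensor : StarModule ℂ (⨂[ℂ] i, A i) where
  star_smul c t := map_smulₛₗ starMap c t

variable (A) in
/-- `⨂^ut A i = ⨁_{ω} ⨂^ω A i`, where `ω` runs over the classes of families of unitaries modulo
finite changes and `⨂^ω A i` is spanned by the elementary tensors of families in `ω`: the span of
all `⨂ aᵢ` such that `aᵢ` agrees with some family of unitaries except for finitely many `i`. -/
def utTensor : StarSubalgebra ℂ (⨂[ℂ] i, A i) where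
  carrier := (Submodule.span ℂ {t | ∃ (a : ∀ i, A i) (u : ∀ i, unitary (A i)),
    {i | a i ≠ u i}.Finite ∧ PiTensorProduct.tprod ℂ a = t} : Submodule ℂ (⨂[ℂ] i, A i))
  mul_mem' {s t} hs ht := by
    have h := Submodule.mul_mem_mul hs ht
    rw [Submodule.span_mul_span] at h
    refine Submodule.span_mono ?_ h
    rintro _ ⟨_, ⟨a, u, hu, rfl⟩, _, ⟨b, v, hv, rfl⟩, rfl⟩
    refine ⟨a * b, u * v, (hu.union hv).subset ?_, by simp⟩
    intro i hi
    by_contra hcon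
    simp only [Set.mem_union, Set.mem_ofPred_eq, not_or, not_not] at hcon
    exact hi (by simp [hcon.1, hcon.2])
  add_mem' hs ht := Submodule.add_mem _ hs ht
  algebraMap_mem' r := by
    rw [Algebra.algebraMap_eq_smul_one]
    exact Submodule.smul_mem _ _ (Submodule.subset_span ⟨1, 1, by simp, rfl⟩)
  star_mem' {t} ht := by
    induction ht using Submodule.span_induction with
    | mem x hx =>
      obtain ⟨a, u, hu, rfl⟩ := hx
      refine Submodule.subset_span ⟨star a, star u, hu.subset ?_, (star_tprod a).symm⟩
      intro i hi hcon
      exact hi (by simp [hcon])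
    | zero => rw [star_zero]; exact Submodule.zero_mem _
    | add x y _ _ hx hy => rw [star_add]; exact Submodule.add_mem _ hx hy
    | smul c x _ hx => rw [star_smul]; exact Submodule.smul_mem _ _ hx

end StarAlgebra

/-- When the `A i` are unital C*-algebras, `⨂^ut A i` is spanned by the tensors of unitaries. -/
theorem mem_span_unitary {I : Type*} {A : I → Type*} [∀ i, CStarAlgebra (A i)]
    {t : ⨂[ℂ] i, A i} (ht : t ∈ utTensor A) :
    t ∈ Submodule.span ℂ (Set.range fun u : ∀ i, unitary (A i) =>
      PiTensorProduct.tprod ℂ fun i => (u i : A i)) := by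
  classical
  set S := Submodule.span ℂ (Set.range fun u : ∀ i, unitary (A i) =>
      PiTensorProduct.tprod ℂ fun i => (u i : A i)) with hS
  have key : ∀ (F : Finset I) (a : ∀ i, A i) (u : ∀ i, unitary (A i)),
      (∀ i, i ∉ F → a i = u i) → PiTensorProduct.tprod ℂ a ∈ S := by
    intro F
    induction F using Finset.induction_on with
    | empty =>
      intro a u h
      refine Submodule.subset_span ⟨u, ?_⟩
      exact congrArg (PiTensorProduct.tprod ℂ) (funext fun i => (h i (by simp)).symm)
    | insert j F hj ih =>
      intro a u h
      have h1 : ∀ b : A j, PiTensorProduct.tprod ℂ (update a j b) ∈ S := by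
        intro b
        have hb : b ∈ Submodule.span ℂ (unitary (A j) : Set (A j)) := by
          rw [CStarAlgebra.span_unitary]; trivial
        induction hb using Submodule.span_induction with
        | mem x hx =>
          refine ih _ (update u j ⟨x, hx⟩) ?_
          intro i hi
          by_cases hij : i = j
          · subst hij; simp
          · simp only [update_of_ne hij]
            exact h i (by simp [hij, hi])
        | zero => rw [MultilinearMap.map_update_zero]; exact Submodule.zero_mem _
        | add x y _ _ hx hy =>
          rw [MultilinearMap.map_update_add]; exact Submodule.add_mem _ hx hy
        | smul c x _ hx =>
          rw [MultilinearMap.map_update_smul]; exact Submodule.smul_mem _ _ hx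
      simpa using h1 (a j)
  have ht' : t ∈ Submodule.span ℂ {t | ∃ (a : ∀ i, A i) (u : ∀ i, unitary (A i)),
    {i | a i ≠ u i}.Finite ∧ PiTensorProduct.tprod ℂ a = t} := ht
  refine Submodule.span_le.2 ?_ ht'
  rintro _ ⟨a, u, hu, rfl⟩
  refine key hu.toFinset a u ?_
  intro i hi
  simpa using hi

/-! ### The functional `φ₁` and the inner product on `⨂^un H i` -/

open Classical in
/-- `varphi β = ∏ βᵢ` if `βᵢ = 1` for all but finitely many `i`, and `0` otherwise. -/
def varphi {I : Type*} (β : I → ℂ) : ℂ := if {i | β i ≠ 1}.Finite then ∏ᶠ i, β i else 0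

theorem varphi_eq_prod {I : Type*} {β : I → ℂ} {F : Finset I} (h : ∀ i, i ∉ F → β i = 1) :
    varphi β = ∏ i ∈ F, β i := by
  have hsub : mulSupport β ⊆ F := by
    intro i hi
    by_contra hcon
    exact hi (h i hcon)
  have hfin : {i | β i ≠ 1}.Finite := F.finite_toSet.subset hsub
  rw [varphi, if_pos hfin, finprod_eq_prod_of_mulSupport_subset β hsub]

theorem varphi_eq_zero {I : Type*} {β : I → ℂ} (h : ¬ {i | β i ≠ 1}.Finite) : varphi β = 0 :=
  if_neg h

theorem varphi_update {I : Type*} [DecidableEq I] (β : I → ℂ) (j : I) (c : ℂ) :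
    varphi (update β j c) = c * varphi (update β j 1) := by
  by_cases h : {i | update β j 1 i ≠ 1}.Finite
  · rw [varphi_eq_prod (F := insert j h.toFinset), varphi_eq_prod (F := h.toFinset),
      Finset.prod_insert (by simp)]
    · congr 1
      · simp
      · refine Finset.prod_congr rfl fun i hi => ?_
        have : i ≠ j := by rintro rfl; simp at hi
        simp [update_of_ne this]
    · intro i hi
      simpa using hi
    · intro i hi
      simp only [Finset.mem_insert, Set.Finite.mem_toFinset, Set.mem_ofPred_eq, not_or,
        not_not] at hi
      rw [← hi.2, update_of_ne hi.1, update_of_ne hi.1]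
  · rw [varphi_eq_zero h, varphi_eq_zero, mul_zero]
    refine fun hf => h (hf.subset ?_)
    intro i hi
    have : i ≠ j := by rintro rfl; simp at hi
    simpa [update_of_ne this] using hi

/-- The linear functional `φ₁` on `⨂ ℂ` with `φ₁ (⨂ βᵢ) = varphi β`. -/
def phi₁ (I : Type*) : (⨂[ℂ] _ : I, ℂ) →ₗ[ℂ] ℂ :=
  PiTensorProduct.lift
    { toFun := fun β => varphi β
      map_update_add' := by
        intro _ β j a b
        rw [varphi_update, varphi_update β j a, varphi_update β j b, add_mul]
      map_update_smul' := by
        intro _ β j c a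
        rw [varphi_update, varphi_update β j a, smul_eq_mul, smul_eq_mul, mul_assoc] }

theorem phi₁_tprod {I : Type*} (β : I → ℂ) : phi₁ I (PiTensorProduct.tprod ℂ β) = varphi β :=
  PiTensorProduct.lift.tprod β

section InnerProduct

variable {I : Type*} {H : I → Type*} [∀ i, NormedAddCommGroup (H i)]
  [∀ i, InnerProductSpace ℂ (H i)]

/-- The `⨂ ℂ`-valued Hermitian form on `⨂ H i` with `⟨⨂ xᵢ, ⨂ yᵢ⟩ = ⨂ ⟨xᵢ, yᵢ⟩`
(conjugate-linear in the first variable). -/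
def hermForm : (⨂[ℂ] i, H i) →ₗ⋆[ℂ] (⨂[ℂ] i, H i) →ₗ[ℂ] (⨂[ℂ] _ : I, ℂ) :=
  conjLift (fun x => PiTensorProduct.map fun i => innerₛₗ ℂ (x i))
    (fun x i a b => by
      rw [← PiTensorProduct.mapMultilinear_apply, ← PiTensorProduct.mapMultilinear_apply,
        ← PiTensorProduct.mapMultilinear_apply]
      have (c : H i) : (fun k => innerₛₗ ℂ (update x i c k)) =
          update (fun k => innerₛₗ ℂ (x k)) i (innerₛₗ ℂ c) := by
        ext1 k
        exact apply_update (fun i (y : H i) => innerₛₗ ℂ y) x i c k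
      simp only [this, map_add, MultilinearMap.map_update_add])
    (fun x i c a => by
      rw [← PiTensorProduct.mapMultilinear_apply, ← PiTensorProduct.mapMultilinear_apply]
      have (c : H i) : (fun k => innerₛₗ ℂ (update x i c k)) =
          update (fun k => innerₛₗ ℂ (x k)) i (innerₛₗ ℂ c) := by
        ext1 k
        exact apply_update (fun i (y : H i) => innerₛₗ ℂ y) x i c k
      simp only [this, map_smulₛₗ, MultilinearMap.map_update_smul])

theorem hermForm_tprod (x y : ∀ i, H i) :
    hermForm (PiTensorProduct.tprod ℂ x) (PiTensorProduct.tprod ℂ y) =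
      PiTensorProduct.tprod ℂ fun i => ⟪x i, y i⟫_ℂ := by
  have h : hermForm (PiTensorProduct.tprod ℂ x) = PiTensorProduct.map fun i => innerₛₗ ℂ (x i) :=
    PiTensorProduct.lift.tprod (R := ℂ) (E := ConjMod ((⨂[ℂ] i, H i) →ₗ[ℂ] (⨂[ℂ] _ : I, ℂ))) x
  rw [h, PiTensorProduct.map_tprod]
  rfl

/-- The sesquilinear form `⟨ξ, η⟩_{φ₁} = φ₁ ⟨ξ, η⟩` on `⨂ H i`. -/
def phiForm : (⨂[ℂ] i, H i) →ₗ⋆[ℂ] (⨂[ℂ] i, H i) →ₗ[ℂ] ℂ :=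
  hermForm.compr₂ₛₗ (phi₁ I)

theorem phiForm_tprod (x y : ∀ i, H i) :
    phiForm (PiTensorProduct.tprod ℂ x) (PiTensorProduct.tprod ℂ y) =
      varphi fun i => ⟪x i, y i⟫_ℂ := by
  change phi₁ I (hermForm (PiTensorProduct.tprod ℂ x) (PiTensorProduct.tprod ℂ y)) = _
  rw [hermForm_tprod, phi₁_tprod]

theorem varphi_conj (β : I → ℂ) :
    varphi (fun i => (starRingEnd ℂ) (β i)) = (starRingEnd ℂ) (varphi β) := by
  have h1 (i : I) : (starRingEnd ℂ) (β i) = 1 ↔ β i = 1 :=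
    map_eq_one_iff (starRingEnd ℂ) (starRingEnd ℂ).injective
  by_cases h : {i | β i ≠ 1}.Finite
  · rw [varphi_eq_prod (F := h.toFinset) (β := β), varphi_eq_prod (F := h.toFinset), map_prod]
    · intro i hi
      simpa [h1] using hi
    · intro i hi
      simpa using hi
  · rw [varphi_eq_zero h, varphi_eq_zero, map_zero]
    simpa [h1] using h

theorem phiForm_conj (s t : ⨂[ℂ] i, H i) :
    (starRingEnd ℂ) (phiForm s t) = phiForm t s := by
  induction s using PiTensorProduct.induction_on with
  | smul_tprod r x =>
    induction t using PiTensorProduct.induction_on with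
    | smul_tprod q y =>
      simp only [map_smulₛₗ, LinearMap.smul_apply, phiForm_tprod, smul_eq_mul, map_mul,
        ← varphi_conj, inner_conj_symm, RingHom.id_apply, Complex.conj_conj]
      ring
    | add t₁ t₂ h₁ h₂ => simp only [map_add, LinearMap.add_apply, h₁, h₂]
  | add s₁ s₂ h₁ h₂ => simp only [map_add, LinearMap.add_apply, h₁, h₂]

/-- On families of unit vectors, the kernel of the form is positive semidefinite. -/
theorem posSemidef_kernel {κ : Type*} [Finite κ] (x : κ → ∀ i, H i) (hx : ∀ k i, ‖x k i‖ = 1) :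
    (Matrix.of fun k l => varphi fun i => ⟪x k i, x l i⟫_ℂ).PosSemidef := by
  classical
  have := Fintype.ofFinite κ
  have hone (k l : κ) (i : I) : ⟪x k i, x l i⟫_ℂ = 1 ↔ x k i = x l i :=
    inner_eq_one_iff_of_norm_eq_one (hx k i) (hx l i)
  let r : Setoid κ :=
    { r := fun k l => {i | x k i ≠ x l i}.Finite
      iseqv :=
        { refl := fun k => by simp
          symm := fun {k l} h => by simpa only [ne_comm] using h
          trans := fun {k l m} h h' => (h.union h').subset fun i hi => by
            by_contra hcon
            simp only [Set.mem_union, Set.mem_ofPred_eq, not_or, not_not] at hcon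
            exact hi (hcon.1.trans hcon.2) } }
  let F : Finset I := Finset.univ.biUnion fun p : κ × κ =>
    if h : {i | x p.1 i ≠ x p.2 i}.Finite then h.toFinset else ∅
  let E : Matrix κ κ ℂ := Matrix.of fun k l => if r k l then 1 else 0
  have hE : E.PosSemidef := by
    let B : Matrix (Quotient r) κ ℂ := Matrix.of fun q k => if q = Quotient.mk r k then 1 else 0
    have : E = B.conjTranspose * B := by
      ext k l
      simp only [E, B, Matrix.mul_apply, Matrix.conjTranspose_apply, Matrix.of_apply]
      simp only [apply_ite star, star_one, star_zero, mul_ite, mul_one, mul_zero,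
        Finset.sum_ite_eq', Finset.mem_univ, if_true]
      by_cases h : r k l
      · rw [if_pos h, if_pos (Quotient.sound (Setoid.symm h))]
      · rw [if_neg h, if_neg fun hq => h (Setoid.symm (Quotient.exact hq))]
    rw [this]
    exact Matrix.posSemidef_conjTranspose_mul_self B
  have hP : ∀ G : Finset I,
      (Matrix.of fun k l => (if r k l then 1 else 0) * ∏ i ∈ G, ⟪x k i, x l i⟫_ℂ).PosSemidef := by
    intro G
    induction G using Finset.induction_on with
    | empty => simpa using hE
    | insert j G hj ih =>
      have := (Matrix.posSemidef_gram ℂ fun k => x k j).hadamard ih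
      have heq : (Matrix.of fun k l => (if r k l then 1 else 0) * ∏ i ∈ insert j G,
          ⟪x k i, x l i⟫_ℂ) = (Matrix.gram ℂ fun k => x k j).hadamard
          (Matrix.of fun k l => (if r k l then 1 else 0) * ∏ i ∈ G, ⟪x k i, x l i⟫_ℂ) := by
        ext k l
        simp only [Matrix.of_apply, Finset.prod_insert hj, Matrix.hadamard_apply,
          Matrix.gram_apply]
        ring
      rw [heq]
      exact this
  convert hP F using 1
  ext k l
  simp only [Matrix.of_apply]
  by_cases h : r k l
  · rw [if_pos h, one_mul, varphi_eq_prod]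
    intro i hi
    rw [hone]
    by_contra hcon
    refine hi (Finset.mem_biUnion.2 ⟨(k, l), Finset.mem_univ _, ?_⟩)
    have h' : {i | x k i ≠ x l i}.Finite := h
    rw [dif_pos h']
    simpa using hcon
  · rw [if_neg h, zero_mul, varphi_eq_zero]
    have h' : ¬ {i | x k i ≠ x l i}.Finite := h
    simpa only [ne_eq, hone] using h'

variable (H) in
/-- `⨂^un H i`: the span of the elementary tensors of families of unit vectors. -/
def unTensor : Submodule ℂ (⨂[ℂ] i, H i) :=
  Submodule.span ℂ {t | ∃ x : ∀ i, H i, (∀ i, ‖x i‖ = 1) ∧ PiTensorProduct.tprod ℂ x = t}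

theorem phiForm_self_nonneg {t : ⨂[ℂ] i, H i} (ht : t ∈ unTensor H) : 0 ≤ phiForm t t := by
  classical
  obtain ⟨c, hc, rfl⟩ := (Submodule.mem_span_set (R := ℂ)).1 ht
  let κ := c.support
  choose x hx hxt using fun k : κ => hc k.2
  have h := (posSemidef_kernel x hx).dotProduct_mulVec_nonneg fun k : κ => c k
  convert h using 1
  rw [Finsupp.sum, ← Finset.sum_coe_sort]
  simp only [map_sum, LinearMap.sum_apply, map_smulₛₗ, LinearMap.smul_apply, dotProduct,
    Matrix.mulVec, Matrix.of_apply, smul_eq_mul, RingHom.id_apply, Pi.star_apply, Finset.mul_sum]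
  rw [Finset.sum_comm]
  refine Finset.sum_congr rfl fun k _ => Finset.sum_congr rfl fun l _ => ?_
  rw [← phiForm_tprod, hxt, hxt]
  simp only [RCLike.star_def]
  ring

variable (H) in
/-- `⨂^un H i` as a type, carrying the inner product `⟨·,·⟩_{φ₁}`. -/
def UnTensor : Type _ := unTensor H

instance : AddCommGroup (UnTensor H) := inferInstanceAs (AddCommGroup (unTensor H))

instance : Module ℂ (UnTensor H) := inferInstanceAs (Module ℂ (unTensor H))

variable (H) in
/-- The inclusion of `⨂^un H i` into `⨂ H i`. -/
def unIncl : UnTensor H →ₗ[ℂ] ⨂[ℂ] i, H i := (unTensor H).subtype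

theorem unIncl_injective : Injective (unIncl H) := Subtype.val_injective

variable (H) in
/-- The positive sesquilinear form `⟨·,·⟩_{φ₁}` on `⨂^un H i`. -/
@[reducible] def unCore : PreInnerProductSpace.Core ℂ (UnTensor H) where
  inner ξ η := phiForm (unIncl H ξ) (unIncl H η)
  conj_inner_symm ξ η := phiForm_conj _ _
  re_inner_nonneg ξ := (RCLike.nonneg_iff.1 (phiForm_self_nonneg ξ.2)).1
  add_left ξ η ζ := by rw [map_add, map_add, LinearMap.add_apply]
  smul_left ξ η c := by rw [map_smul, map_smulₛₗ, LinearMap.smul_apply, smul_eq_mul]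

instance : SeminormedAddCommGroup (UnTensor H) :=
  InnerProductSpace.Core.toSeminormedAddCommGroup (c := unCore H)

instance : InnerProductSpace ℂ (UnTensor H) := InnerProductSpace.ofCore (unCore H)

theorem unTensor_inner_def (ξ η : UnTensor H) :
    ⟪ξ, η⟫_ℂ = phiForm (unIncl H ξ) (unIncl H η) := rfl

variable (H) in
/-- The Hilbert space completion of `⨂^un H i` for the inner product `⟨·,·⟩_{φ₁}`. (Completions
are Hausdorff, so only the semidefiniteness of the form is needed to define it.) -/
abbrev PhiTensor : Type _ := UniformSpace.Completion (UnTensor H)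

end InnerProduct

/-! ### Tensor products of *-representations -/

section Representation

variable {I : Type*} {A : I → Type*} [∀ i, CStarAlgebra (A i)]
  {H : I → Type*} [∀ i, NormedAddCommGroup (H i)] [∀ i, InnerProductSpace ℂ (H i)]
  [∀ i, CompleteSpace (H i)] (Ψ : ∀ i, A i →⋆ₐ[ℂ] (H i →L[ℂ] H i))

/-- The canonical action of `⨂ A i` on `⨂ H i`: `(⨂ aᵢ) (⨂ xᵢ) = ⨂ Ψᵢ(aᵢ) xᵢ`. -/
def tensorAction : (⨂[ℂ] i, A i) →ₗ[ℂ] (⨂[ℂ] i, H i) →ₗ[ℂ] (⨂[ℂ] i, H i) :=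
  PiTensorProduct.piTensorHomMap ∘ₗ PiTensorProduct.map fun i =>
    ContinuousLinearMap.coeLM ℂ ∘ₗ (Ψ i).toAlgHom.toLinearMap

theorem tensorAction_tprod (a : ∀ i, A i) (x : ∀ i, H i) :
    tensorAction Ψ (PiTensorProduct.tprod ℂ a) (PiTensorProduct.tprod ℂ x) =
      PiTensorProduct.tprod ℂ fun i => Ψ i (a i) (x i) := by
  simp [tensorAction]

theorem tensorAction_one : tensorAction Ψ 1 = LinearMap.id :=
  semilin_ext fun x => by simp [PiTensorProduct.one_def, tensorAction_tprod]

theorem tensorAction_mul (a b : ⨂[ℂ] i, A i) :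
    tensorAction Ψ (a * b) = tensorAction Ψ a ∘ₗ tensorAction Ψ b := by
  induction a using PiTensorProduct.induction_on with
  | smul_tprod r x =>
    induction b using PiTensorProduct.induction_on with
    | smul_tprod q y =>
      refine semilin_ext fun z => ?_
      simp [tensorAction_tprod, smul_smul, mul_comm]
    | add b₁ b₂ h₁ h₂ => rw [mul_add, map_add, map_add, h₁, h₂, LinearMap.comp_add]
  | add a₁ a₂ h₁ h₂ => rw [add_mul, map_add, map_add, h₁, h₂, LinearMap.add_comp]

theorem phiForm_tensorAction (a : ⨂[ℂ] i, A i) (s t : ⨂[ℂ] i, H i) :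
    phiForm (tensorAction Ψ a s) t = phiForm s (tensorAction Ψ (star a) t) := by
  induction a using PiTensorProduct.induction_on with
  | smul_tprod r a =>
    induction s using PiTensorProduct.induction_on with
    | smul_tprod p x =>
      induction t using PiTensorProduct.induction_on with
      | smul_tprod q y =>
        have h : ∀ i, ⟪Ψ i (a i) (x i), y i⟫_ℂ = ⟪x i, Ψ i (star (a i)) (y i)⟫_ℂ := by
          intro i
          rw [map_star, ContinuousLinearMap.star_eq_adjoint,
            ContinuousLinearMap.adjoint_inner_right]
        simp only [star_smul, star_tprod, map_smulₛₗ, LinearMap.smul_apply, tensorAction_tprod,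
          phiForm_tprod, h, Pi.star_apply, RingHom.id_apply, smul_eq_mul, RCLike.star_def]
        ring
      | add t₁ t₂ h₁ h₂ => simp only [map_add, h₁, h₂]
    | add s₁ s₂ h₁ h₂ => simp only [map_add, LinearMap.add_apply, h₁, h₂]
  | add a₁ a₂ h₁ h₂ => simp only [map_add, star_add, LinearMap.add_apply, h₁, h₂]

theorem norm_unitary_apply {i : I} (u : unitary (A i)) (x : H i) : ‖Ψ i u x‖ = ‖x‖ := by
  have h : ⟪Ψ i u x, Ψ i u x⟫_ℂ = ⟪x, x⟫_ℂ := by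
    rw [← ContinuousLinearMap.adjoint_inner_right, ← ContinuousLinearMap.star_eq_adjoint,
      ← map_star, ← mul_apply_eq_comp, ← map_mul, Unitary.star_mul_self_of_mem u.2,
      map_one, one_apply_eq_self]
  rw [@norm_eq_sqrt_re_inner ℂ, @norm_eq_sqrt_re_inner ℂ _ _ _ _ x, h]

theorem tensorAction_mem {a : ⨂[ℂ] i, A i} (ha : a ∈ utTensor A) {s : ⨂[ℂ] i, H i}
    (hs : s ∈ unTensor H) : tensorAction Ψ a s ∈ unTensor H := by
  have ha' := mem_span_unitary ha
  clear ha
  induction ha' using Submodule.span_induction with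
  | mem a h =>
    obtain ⟨u, rfl⟩ := h
    induction hs using Submodule.span_induction with
    | mem s h =>
      obtain ⟨x, hx, rfl⟩ := h
      refine Submodule.subset_span ⟨fun i => Ψ i (u i) (x i), fun i => ?_, ?_⟩
      · rw [norm_unitary_apply, hx]
      · rw [tensorAction_tprod]
    | zero => rw [map_zero]; exact Submodule.zero_mem _
    | add x y _ _ hx hy => rw [map_add]; exact Submodule.add_mem _ hx hy
    | smul c x _ hx => rw [map_smul]; exact Submodule.smul_mem _ _ hx
  | zero => rw [map_zero]; exact Submodule.zero_mem _
  | add x y _ _ hx hy => rw [map_add]; exact Submodule.add_mem _ hx hy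
  | smul c x _ hx => rw [map_smul]; exact Submodule.smul_mem _ _ hx

/-- The action of an element of `⨂^ut A i` on `⨂^un H i`. -/
def unAction (a : utTensor A) : UnTensor H →ₗ[ℂ] UnTensor H :=
  (tensorAction Ψ (a : ⨂[ℂ] i, A i)).restrict fun _ hs => tensorAction_mem Ψ a.2 hs

theorem unIncl_unAction (a : utTensor A) (ξ : UnTensor H) :
    unIncl H (unAction Ψ a ξ) = tensorAction Ψ a (unIncl H ξ) := rfl

end Representation

/-- Each element of `⨂^ut A i` acts boundedly, with a bound independent of the representations. -/
theorem unAction_bound.{u, v, w} {I : Type u} {A : I → Type v} [∀ i, CStarAlgebra (A i)]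
    (a : utTensor A) : ∃ C : ℝ, 0 ≤ C ∧
      ∀ (H : I → Type w) [∀ i, NormedAddCommGroup (H i)] [∀ i, InnerProductSpace ℂ (H i)]
        [∀ i, CompleteSpace (H i)] (Ψ : ∀ i, A i →⋆ₐ[ℂ] (H i →L[ℂ] H i)) (ξ : UnTensor H),
        ‖unAction Ψ a ξ‖ ≤ C * ‖ξ‖ := by
  obtain ⟨a, ha⟩ := a
  have hmem : ∀ u : ∀ i, unitary (A i),
      PiTensorProduct.tprod ℂ (fun i => (u i : A i)) ∈ utTensor A := fun u =>
    Submodule.subset_span ⟨_, u, by simp, rfl⟩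
  have hle : Submodule.span ℂ (Set.range fun u : ∀ i, unitary (A i) =>
      PiTensorProduct.tprod ℂ fun i => (u i : A i)) ≤ (utTensor A).toSubalgebra.toSubmodule := by
    rw [Submodule.span_le]
    rintro _ ⟨u, rfl⟩
    exact hmem u
  have key : ∀ b ∈ Submodule.span ℂ (Set.range fun u : ∀ i, unitary (A i) =>
      PiTensorProduct.tprod ℂ fun i => (u i : A i)), ∀ hb : b ∈ utTensor A,
      ∃ C : ℝ, 0 ≤ C ∧
      ∀ (H : I → Type w) [∀ i, NormedAddCommGroup (H i)] [∀ i, InnerProductSpace ℂ (H i)]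
        [∀ i, CompleteSpace (H i)] (Ψ : ∀ i, A i →⋆ₐ[ℂ] (H i →L[ℂ] H i)) (ξ : UnTensor H),
        ‖unAction Ψ ⟨b, hb⟩ ξ‖ ≤ C * ‖ξ‖ := by
    intro b hb
    induction hb using Submodule.span_induction with
    | mem b h =>
      obtain ⟨u, rfl⟩ := h
      refine fun hb => ⟨1, zero_le_one, fun H _ _ _ Ψ ξ => ?_⟩
      have hin : ⟪unAction Ψ ⟨_, hb⟩ ξ, unAction Ψ ⟨_, hb⟩ ξ⟫_ℂ = ⟪ξ, ξ⟫_ℂ := by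
        rw [unTensor_inner_def, unTensor_inner_def, unIncl_unAction, phiForm_tensorAction,
          ← LinearMap.comp_apply (tensorAction Ψ _), ← tensorAction_mul, star_tprod, PiTensorProduct.tprod_mul_tprod]
        have : star (fun i => (u i : A i)) * (fun i => (u i : A i)) = 1 := by
          funext i
          exact Unitary.star_mul_self_of_mem (u i).2
        rw [this, ← PiTensorProduct.one_def, tensorAction_one, LinearMap.id_apply]
      rw [one_mul, @norm_eq_sqrt_re_inner ℂ, @norm_eq_sqrt_re_inner ℂ _ _ _ _ ξ, hin]
    | zero =>
      refine fun hb => ⟨0, le_rfl, fun H _ _ _ Ψ ξ => ?_⟩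
      have : unAction Ψ ⟨0, hb⟩ ξ = 0 := unIncl_injective (by
        rw [unIncl_unAction, map_zero, map_zero, LinearMap.zero_apply])
      rw [this, norm_zero, zero_mul]
    | add x y hx' hy' hx hy =>
      intro hb
      obtain ⟨C, hC, h⟩ := hx (hle hx')
      obtain ⟨D, hD, h'⟩ := hy (hle hy')
      refine ⟨C + D, add_nonneg hC hD, fun H _ _ _ Ψ ξ => ?_⟩
      have : unAction Ψ ⟨x + y, hb⟩ ξ = unAction Ψ ⟨x, hle hx'⟩ ξ + unAction Ψ ⟨y, hle hy'⟩ ξ :=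
        unIncl_injective (by
          simp only [unIncl_unAction, map_add, LinearMap.add_apply])
      rw [this, add_mul]
      exact (norm_add_le _ _).trans (add_le_add (h H Ψ ξ) (h' H Ψ ξ))
    | smul c x hx' hx =>
      intro hb
      obtain ⟨C, hC, h⟩ := hx (hle hx')
      refine ⟨‖c‖ * C, by positivity, fun H _ _ _ Ψ ξ => ?_⟩
      have : unAction Ψ ⟨c • x, hb⟩ ξ = c • unAction Ψ ⟨x, hle hx'⟩ ξ :=
        unIncl_injective (by simp only [unIncl_unAction, map_smul, LinearMap.smul_apply])
      rw [this, norm_smul, mul_assoc]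
      exact mul_le_mul_of_nonneg_left (h H Ψ ξ) (norm_nonneg c)
  exact key a (mem_span_unitary ha) ha

section Representation

variable {I : Type*} {A : I → Type*} [∀ i, CStarAlgebra (A i)]
  {H : I → Type*} [∀ i, NormedAddCommGroup (H i)] [∀ i, InnerProductSpace ℂ (H i)]
  [∀ i, CompleteSpace (H i)] (Ψ : ∀ i, A i →⋆ₐ[ℂ] (H i →L[ℂ] H i))

/-- The action of an element of `⨂^ut A i` on `⨂^un H i`, as a bounded operator. -/
def unActionL (a : utTensor A) : UnTensor H →L[ℂ] UnTensor H :=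
  (unAction Ψ a).mkContinuousOfExistsBound (by
    obtain ⟨C, -, h⟩ := unAction_bound a
    exact ⟨C, h H Ψ⟩)

theorem unActionL_apply (a : utTensor A) (ξ : UnTensor H) :
    unActionL Ψ a ξ = unAction Ψ a ξ := rfl

theorem completion_ext {E : Type*} [SeminormedAddCommGroup E] [InnerProductSpace ℂ E]
    {S T : UniformSpace.Completion E →L[ℂ] UniformSpace.Completion E}
    (h : ∀ ξ : E, S ξ = T ξ) : S = T := by
  ext ζ
  induction ζ using UniformSpace.Completion.induction_on with
  | hp => exact isClosed_eq S.continuous T.continuous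
  | ih ξ => exact h ξ

/-- The *-representation `⨂^{φ₁} Ψ i` of `⨂^ut A i` on the Hilbert space `PhiTensor H`. -/
def phiRep : utTensor A →⋆ₐ[ℂ] (PhiTensor H →L[ℂ] PhiTensor H) where
  toFun a := (unActionL Ψ a).completion
  map_one' := completion_ext fun ξ => by
    rw [ContinuousLinearMap.completion_apply_coe]
    exact congrArg _ (unIncl_injective (by
      rw [unActionL_apply, unIncl_unAction]
      exact LinearMap.congr_fun (tensorAction_one Ψ) _))
  map_mul' a b := completion_ext fun ξ => by
    rw [mul_apply_eq_comp, ContinuousLinearMap.completion_apply_coe,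
      ContinuousLinearMap.completion_apply_coe, ContinuousLinearMap.completion_apply_coe]
    exact congrArg _ (unIncl_injective (LinearMap.congr_fun (tensorAction_mul Ψ _ _) _))
  map_zero' := completion_ext fun ξ => by
    rw [ContinuousLinearMap.completion_apply_coe, zero_apply,
      ← UniformSpace.Completion.coe_zero]
    exact congrArg _ (unIncl_injective (LinearMap.congr_fun (map_zero (tensorAction Ψ)) _))
  map_add' a b := completion_ext fun ξ => by
    rw [add_apply, ContinuousLinearMap.completion_apply_coe,
      ContinuousLinearMap.completion_apply_coe, ContinuousLinearMap.completion_apply_coe,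
      ← UniformSpace.Completion.coe_add]
    exact congrArg _ (unIncl_injective (LinearMap.congr_fun (map_add (tensorAction Ψ) _ _) _))
  commutes' r := completion_ext fun ξ => by
    rw [ContinuousLinearMap.completion_apply_coe, Algebra.algebraMap_eq_smul_one,
      Algebra.algebraMap_eq_smul_one, smul_apply,
      one_apply_eq_self, ← UniformSpace.Completion.coe_smul]
    refine congrArg _ (unIncl_injective ?_)
    rw [unActionL_apply, unIncl_unAction, map_smul]
    change tensorAction Ψ (r • 1) _ = _
    rw [map_smul, tensorAction_one]
    rfl
  map_star' a := by
    rw [ContinuousLinearMap.star_eq_adjoint, ContinuousLinearMap.eq_adjoint_iff]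
    intro ζ η
    induction ζ, η using UniformSpace.Completion.induction_on₂ with
    | hp => apply isClosed_eq <;> fun_prop
    | ih ξ η =>
      rw [ContinuousLinearMap.completion_apply_coe, ContinuousLinearMap.completion_apply_coe,
        UniformSpace.Completion.inner_coe, UniformSpace.Completion.inner_coe,
        unTensor_inner_def, unTensor_inner_def, unActionL_apply, unActionL_apply,
        unIncl_unAction, unIncl_unAction, phiForm_tensorAction]
      change _ = phiForm _ (tensorAction Ψ _ _)
      rw [StarMemClass.coe_star, star_star]

theorem phiRep_coe (a : utTensor A) (ξ : UnTensor H) :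
    phiRep Ψ a (ξ : PhiTensor H) = (unAction Ψ a ξ : PhiTensor H) :=
  ContinuousLinearMap.completion_apply_coe _ _

theorem exists_bound_phiRep.{u, v, w} {I : Type u} {A : I → Type v} [∀ i, CStarAlgebra (A i)]
    (a : utTensor A) : ∃ C : ℝ, 0 ≤ C ∧
      ∀ (H : I → Type w) [∀ i, NormedAddCommGroup (H i)] [∀ i, InnerProductSpace ℂ (H i)]
        [∀ i, CompleteSpace (H i)] (Ψ : ∀ i, A i →⋆ₐ[ℂ] (H i →L[ℂ] H i)),
        ‖phiRep Ψ a‖ ≤ C := by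
  obtain ⟨C, hC, h⟩ := unAction_bound a
  refine ⟨C, hC, fun H _ _ _ Ψ => ContinuousLinearMap.opNorm_le_bound _ hC fun ζ => ?_⟩
  induction ζ using UniformSpace.Completion.induction_on with
  | hp => apply isClosed_le <;> fun_prop
  | ih ξ =>
    rw [phiRep_coe, UniformSpace.Completion.norm_coe, UniformSpace.Completion.norm_coe]
    exact h H Ψ ξ

/-- For a family `ξ` of unit vectors, `∑_ω ⨂^{ω·[ξ]} H i`, where `ω` runs over the classes of
families of unitaries of the `A i`: the span of all `⨂ xᵢ` such that, for some family of unitaries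
`uᵢ`, one has `xᵢ = Ψᵢ(uᵢ) ξᵢ` except for finitely many `i`. It is contained in `⨂^un H i`. -/
def orbitSpan (ξ : ∀ i, H i) : Submodule ℂ (⨂[ℂ] i, H i) :=
  Submodule.span ℂ {t | ∃ (x : ∀ i, H i) (u : ∀ i, unitary (A i)),
    {i | x i ≠ Ψ i (u i) (ξ i)}.Finite ∧ PiTensorProduct.tprod ℂ x = t}

/-- The closure of `∑_ω ⨂^{ω·[ξ]} H i` in `PhiTensor H`. -/
def orbitSpace (ξ : ∀ i, H i) : Submodule ℂ (PhiTensor H) :=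
  (((orbitSpan Ψ ξ).comap (unIncl H)).map
    (UniformSpace.Completion.toComplₗᵢ (𝕜 := ℂ) (E := UnTensor H)).toLinearMap).topologicalClosure

theorem tensorAction_mem_orbitSpan (ξ : ∀ i, H i) {a : ⨂[ℂ] i, A i} (ha : a ∈ utTensor A)
    {s : ⨂[ℂ] i, H i} (hs : s ∈ orbitSpan Ψ ξ) : tensorAction Ψ a s ∈ orbitSpan Ψ ξ := by
  have ha' := mem_span_unitary ha
  clear ha
  induction ha' using Submodule.span_induction with
  | mem a h =>
    obtain ⟨v, rfl⟩ := h
    induction hs using Submodule.span_induction with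
    | mem s h =>
      obtain ⟨x, u, hu, rfl⟩ := h
      refine Submodule.subset_span ⟨fun i => Ψ i (v i) (x i), v * u, hu.subset fun i hi => ?_, ?_⟩
      · intro hcon
        exact hi (by simp [hcon])
      · rw [tensorAction_tprod]
    | zero => rw [map_zero]; exact Submodule.zero_mem _
    | add x y _ _ hx hy => rw [map_add]; exact Submodule.add_mem _ hx hy
    | smul c x _ hx => rw [map_smul]; exact Submodule.smul_mem _ _ hx
  | zero => rw [map_zero]; exact Submodule.zero_mem _
  | add x y _ _ hx hy => rw [map_add]; exact Submodule.add_mem _ hx hy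
  | smul c x _ hx => rw [map_smul]; exact Submodule.smul_mem _ _ hx

theorem phiRep_mem_orbitSpace (ξ : ∀ i, H i) (a : utTensor A) {ζ : PhiTensor H}
    (hζ : ζ ∈ orbitSpace Ψ ξ) : phiRep Ψ a ζ ∈ orbitSpace Ψ ξ := by
  have hζ' : ζ ∈ closure (((orbitSpan Ψ ξ).comap (unIncl H)).map
    (UniformSpace.Completion.toComplₗᵢ (𝕜 := ℂ) (E := UnTensor H)).toLinearMap :
      Set (PhiTensor H)) := hζ
  refine map_mem_closure (phiRep Ψ a).continuous hζ' ?_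
  rintro _ ⟨η, hη, rfl⟩
  exact ⟨unAction Ψ a η, tensorAction_mem_orbitSpan Ψ ξ a.2 hη, (phiRep_coe Ψ a η).symm⟩

instance (ξ : ∀ i, H i) : CompleteSpace (orbitSpace Ψ ξ) :=
  IsClosed.completeSpace_coe (s := (orbitSpace Ψ ξ : Set (PhiTensor H)))
    (hs := Submodule.isClosed_topologicalClosure _)

end Representation

/-! ### Subrepresentations and direct sums of *-representations -/

section General

variable {B : Type*} [Ring B] [StarRing B] [Algebra ℂ B]

/-- The restriction of a *-representation to a closed invariant subspace. -/
def subRep {K : Type*} [NormedAddCommGroup K] [InnerProductSpace ℂ K] [CompleteSpace K]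
    (π : B →⋆ₐ[ℂ] (K →L[ℂ] K)) (V : Submodule ℂ K) [CompleteSpace V]
    (hV : ∀ b, ∀ ζ ∈ V, π b ζ ∈ V) : B →⋆ₐ[ℂ] (V →L[ℂ] V) where
  toFun b := ((π b).comp V.subtypeL).codRestrict V fun ζ => hV b ζ ζ.2
  map_one' := by ext ζ; simp
  map_mul' a b := by ext ζ; simp; rfl
  map_zero' := by ext ζ; simp
  map_add' a b := by ext ζ; simp; rfl
  commutes' r := by ext ζ; simp [Algebra.algebraMap_eq_smul_one]
  map_star' b := by
    rw [ContinuousLinearMap.star_eq_adjoint, ContinuousLinearMap.eq_adjoint_iff]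
    intro ζ η
    change ⟪π (star b) ζ, (η : K)⟫_ℂ = ⟪(ζ : K), π b η⟫_ℂ
    rw [map_star, ContinuousLinearMap.star_eq_adjoint, ContinuousLinearMap.adjoint_inner_left]

theorem subRep_apply {K : Type*} [NormedAddCommGroup K] [InnerProductSpace ℂ K] [CompleteSpace K]
    (π : B →⋆ₐ[ℂ] (K →L[ℂ] K)) (V : Submodule ℂ K) [CompleteSpace V]
    (hV : ∀ b, ∀ ζ ∈ V, π b ζ ∈ V) (b : B) (ζ : V) : (subRep π V hV b ζ : K) = π b ζ := rfl

/-- The direct sum of a pointwise bounded family of *-representations, on the Hilbert space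
direct sum: it acts by `(ζ_j) ↦ (π_j(b) ζ_j)`. -/
def directSumRep {J : Type*} {K : J → Type*} [∀ j, NormedAddCommGroup (K j)]
    [∀ j, InnerProductSpace ℂ (K j)] [∀ j, CompleteSpace (K j)]
    (π : ∀ j, B →⋆ₐ[ℂ] (K j →L[ℂ] K j))
    (hπ : ∀ b, ∃ C : ℝ, 0 ≤ C ∧ ∀ j, ‖π j b‖ ≤ C) : B →⋆ₐ[ℂ] (lp K 2 →L[ℂ] lp K 2) where
  toFun b := lp.mapCLM 2 (fun j => π j b) (hπ b).choose_spec.1 (hπ b).choose_spec.2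
  map_one' := by ext ζ j; simp
  map_mul' a b := by ext ζ j; simp
  map_zero' := by ext ζ j; simp
  map_add' a b := by ext ζ j; simp
  commutes' r := by ext ζ j; simp [Algebra.algebraMap_eq_smul_one]
  map_star' b := by
    rw [ContinuousLinearMap.star_eq_adjoint, ContinuousLinearMap.eq_adjoint_iff]
    intro ζ η
    rw [lp.inner_eq_tsum, lp.inner_eq_tsum]
    refine tsum_congr fun j => ?_
    change ⟪π j (star b) (ζ j), η j⟫_ℂ = ⟪ζ j, π j b (η j)⟫_ℂ
    rw [map_star, ContinuousLinearMap.star_eq_adjoint, ContinuousLinearMap.adjoint_inner_left]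

theorem directSumRep_apply {J : Type*} {K : J → Type*} [∀ j, NormedAddCommGroup (K j)]
    [∀ j, InnerProductSpace ℂ (K j)] [∀ j, CompleteSpace (K j)]
    (π : ∀ j, B →⋆ₐ[ℂ] (K j →L[ℂ] K j))
    (hπ : ∀ b, ∃ C : ℝ, 0 ≤ C ∧ ∀ j, ‖π j b‖ ≤ C) (b : B) (ζ : lp K 2) (j : J) :
    directSumRep π hπ b ζ j = π j b (ζ j) := rfl

end General

/-! ### States and the two representations -/

section States

variable {I : Type*} {A : I → Type*} [∀ i, CStarAlgebra (A i)] [∀ i, PartialOrder (A i)]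
  [∀ i, StarOrderedRing (A i)]

/-- The state space of a unital C*-algebra: positive functionals taking the value `1` at `1`. -/
abbrev State (B : Type*) [CStarAlgebra B] [PartialOrder B] : Type _ :=
  {f : B →ₚ[ℂ] ℂ // f 1 = 1}

/-- The canonical cyclic vector of the GNS representation of a state. -/
def gnsVector {B : Type*} [CStarAlgebra B] [PartialOrder B] [StarOrderedRing B] (f : State B) :
    f.1.GNS :=
  (f.1.toPreGNS 1 : f.1.PreGNS)

/-- The Hilbert space `⨂^{φ₁} H_{ρ i}`, for a family `ρ` of states. -/
abbrev GNSTensor (ρ : ∀ i, State (A i)) : Type _ :=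
  PhiTensor fun i => (ρ i).1.GNS

/-- The representation `⨂^{φ₁} π_{ρ i}` of `⨂^ut A i`. -/
def gnsRep (ρ : ∀ i, State (A i)) : utTensor A →⋆ₐ[ℂ] (GNSTensor ρ →L[ℂ] GNSTensor ρ) :=
  phiRep fun i => (ρ i).1.gnsStarAlgHom

/-- The closed subspace `⨁_ω ⨂^{ω·[ξ_ρ]} H_{ρ i}` of `⨂^{φ₁} H_{ρ i}`, where `ξ_ρ` is the family
of the canonical cyclic vectors and `ω` runs over the classes of families of unitaries. -/
def checkSpace (ρ : ∀ i, State (A i)) : Submodule ℂ (GNSTensor ρ) :=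
  orbitSpace (fun i => (ρ i).1.gnsStarAlgHom) fun i => gnsVector (ρ i)

instance (ρ : ∀ i, State (A i)) : CompleteSpace (checkSpace ρ) :=
  inferInstanceAs (CompleteSpace (orbitSpace _ _))

/-- The restriction of `⨂^{φ₁} π_{ρ i}` to `checkSpace ρ`. -/
def checkRep (ρ : ∀ i, State (A i)) : utTensor A →⋆ₐ[ℂ] (checkSpace ρ →L[ℂ] checkSpace ρ) :=
  subRep (gnsRep ρ) (checkSpace ρ) fun a _ hζ => phiRep_mem_orbitSpace _ _ a hζ

theorem gnsRep_bound (a : utTensor A) :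
    ∃ C : ℝ, 0 ≤ C ∧ ∀ ρ : ∀ i, State (A i), ‖gnsRep ρ a‖ ≤ C := by
  obtain ⟨C, hC, h⟩ := exists_bound_phiRep a
  exact ⟨C, hC, fun ρ => h _ _⟩

theorem checkRep_bound (a : utTensor A) :
    ∃ C : ℝ, 0 ≤ C ∧ ∀ ρ : ∀ i, State (A i), ‖checkRep ρ a‖ ≤ C := by
  obtain ⟨C, hC, h⟩ := gnsRep_bound a
  refine ⟨C, hC, fun ρ => ContinuousLinearMap.opNorm_le_bound _ hC fun ζ => ?_⟩
  exact (gnsRep ρ a).le_of_opNorm_le (h ρ) (ζ : GNSTensor ρ)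

variable (A) in
/-- `Ψ_A = ⨁_ρ (H_ρ̌, π_ρ̌)`, over all families `ρ` of states. -/
def checkSumRep : utTensor A →⋆ₐ[ℂ]
    (lp (fun ρ : ∀ i, State (A i) => checkSpace ρ) 2 →L[ℂ]
      lp (fun ρ : ∀ i, State (A i) => checkSpace ρ) 2) :=
  directSumRep checkRep checkRep_bound

variable (A) in
/-- `Φ_A = ⨁_ρ (⨂^{φ₁} H_{ρ i}, ⨂^{φ₁} π_{ρ i})`, over all families `ρ` of states. -/
def gnsSumRep : utTensor A →⋆ₐ[ℂ]
    (lp (fun ρ : ∀ i, State (A i) => GNSTensor ρ) 2 →L[ℂ]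
      lp (fun ρ : ∀ i, State (A i) => GNSTensor ρ) 2) :=
  directSumRep gnsRep gnsRep_bound

end States

end InfTensor

end

/-! An element `t` of the algebra is a finite combination `∑ c_u ⊗u_i` over families of unitaries.
If every `π_ρ̌` kills `t`, then so do all matrix coefficients between `⊗ξ_{ρ_i}` and
`⊗π_{ρ_i}(w_i)ξ_{ρ_i}`, that is, `∑ c_u φ₁(ρ_i(w_i* u_i)) = 0` for all families of states `ρ` and
unitaries `w`. These coefficients determine `t` (`sum_smul_tprod_unitary_eq_zero`).

Isolating a class: group the `u` by equality outside a finite set, and fix a class with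
representative `v`. Some state `τ_i` satisfies `τ_i(v_i* u_i) ≠ 1` for every `u` in the sum with
`u_i ≠ v_i` (`exists_states_star_mul_ne_one`). Using `τ` and `w = v` outside a finite set `F`, a
family outside the class has infinitely many factors different from `1`, so `φ₁` discards it. A
family in the class has all factors outside `F` equal to `1`. With `w = 1` on `F` there remains `∑
c_u ∏_{i ∈ F} ρ_i(u_i) = 0` over the class, with `ρ` arbitrary on `F`.

Inside a class: products of states on finitely many factors separate tensors, by induction on `F`
from the fact that states separate points of each `A_i` (`sum_smul_tprod_eq_zero`).

Since `π_ρ̌` is a restriction of the full representation, the second injectivity follows from the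
first. -/

noncomputable section

namespace InfTensor

/-! ### States separate the points of a unital C*-algebra. -/

section StateSeparation

variable {B : Type*} [CStarAlgebra B]

/-- The complex-linear extension of a real functional, evaluated on real and imaginary parts. -/
def complexify (f : B →ₗ[ℝ] ℝ) : B →ₗ[ℂ] ℂ where
  toFun a := f (realPart a : B) + Complex.I * f (imaginaryPart a : B)
  map_add' a b := by
    simp only [map_add, AddSubgroup.coe_add, Complex.ofReal_add]
    ring
  map_smul' c a := by
    simp only [realPart_smul, imaginaryPart_smul, AddSubgroupClass.coe_sub, AddSubgroup.coe_add,
      selfAdjoint.val_smul, map_add, map_sub, map_smul, smul_eq_mul, RingHom.id_apply]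
    apply Complex.ext <;> simp

theorem complexify_of_isSelfAdjoint (f : B →ₗ[ℝ] ℝ) {a : B} (ha : IsSelfAdjoint a) :
    complexify f a = f a := by
  change (f (realPart a : B) : ℂ) + Complex.I * f (imaginaryPart a : B) = f a
  rw [ha.coe_realPart, ha.imaginaryPart]
  simp

variable [PartialOrder B] [StarOrderedRing B]

/-- A self-adjoint element which is not positive is detected by a state. -/
theorem exists_state_ne_zero_of_not_nonneg {b : B} (hb : IsSelfAdjoint b) (hn : ¬ 0 ≤ b) :
    ∃ f : State B, f.1 b ≠ 0 := by
  -- Hahn–Banach: the positive elements form a closed convex cone missing `b`, so some continuous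
  -- real functional is nonnegative on the cone and negative at `b`.
  obtain ⟨g, hg, hgb⟩ := (ProperCone.positive ℝ B).hyperplane_separation_point (x₀ := b)
    (by simpa using hn)
  replace hg : ∀ x : B, 0 ≤ x → 0 ≤ g x := fun x hx => hg x (by simpa using hx)
  have h1 : 0 < g 1 := by
    -- As `b + ‖b‖` is positive, `g b + ‖b‖ * g 1 ≥ 0`. With `g b < 0` this forces `g 1 > 0`, so `g`
    -- can be normalised to a state.
    have h := hg (b + algebraMap ℝ B ‖b‖)
      (by simpa [neg_le_iff_add_nonneg] using hb.neg_algebraMap_norm_le_self)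
    rw [Algebra.algebraMap_eq_smul_one, map_add, map_smul, smul_eq_mul] at h
    by_contra hcon
    nlinarith [norm_nonneg b]
  refine ⟨⟨.mk₀ (complexify ((g 1)⁻¹ • g.toLinearMap)) fun x hx => ?_, ?_⟩, ?_⟩
  · rw [complexify_of_isSelfAdjoint _ (.of_nonneg hx)]
    exact Complex.zero_le_real.2 (mul_nonneg (inv_nonneg.2 h1.le) (hg x hx))
  · change complexify _ 1 = 1
    rw [complexify_of_isSelfAdjoint _ (.one B)]
    simp [h1.ne']
  · change complexify _ b ≠ 0
    rw [complexify_of_isSelfAdjoint _ hb]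
    simp [h1.ne', hgb.ne]

/-- The states separate the points. -/
theorem exists_state_ne_zero {b : B} (hb : b ≠ 0) : ∃ f : State B, f.1 b ≠ 0 := by
  have hsa : ∀ a : B, IsSelfAdjoint a → a ≠ 0 → ∃ f : State B, f.1 a ≠ 0 := by
    intro a ha h0
    by_cases h : 0 ≤ a
    -- A nonzero positive `a` is handled through `-a`, which is not positive because the cone is
    -- pointed.
    · obtain ⟨f, hf⟩ := exists_state_ne_zero_of_not_nonneg ha.neg
        fun h' => h0 (le_antisymm (neg_nonneg.1 h') h)
      exact ⟨f, by simpa using hf⟩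
    · exact exists_state_ne_zero_of_not_nonneg ha h
  -- States are hermitian, so if all of them vanish at `b` they vanish at the self-adjoint elements
  -- `b + b*` and `i(b - b*)`. Both are then zero, whence `b = 0`.
  by_contra! hcon
  have hstar (f : State B) : f.1 (star b) = 0 := by rw [map_star, hcon, star_zero]
  have h1 : b + star b = 0 := by
    by_contra h
    obtain ⟨f, hf⟩ := hsa _ (IsSelfAdjoint.add_star_self b) h
    exact hf (by rw [map_add, hcon, hstar, add_zero])
  have h2 : Complex.I • (b - star b) = 0 := by
    by_contra h
    obtain ⟨f, hf⟩ := hsa (Complex.I • (b - star b)) (by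
      rw [IsSelfAdjoint, star_smul, star_sub, star_star, RCLike.star_def, Complex.conj_I, neg_smul,
        ← smul_neg, neg_sub]) h
    exact hf (by rw [map_smul, map_sub, hcon, hstar, sub_zero, smul_zero])
  rw [smul_eq_zero_iff_right Complex.I_ne_zero, sub_eq_zero] at h2
  rw [← h2, ← two_smul ℂ b] at h1
  exact hb ((smul_eq_zero_iff_right two_ne_zero).1 h1)

/-! ### One state for finitely many positive elements. -/

/-- The midpoint of two states. -/
def midState (f g : State B) : State B :=
  ⟨.mk₀ ((1 / 2 : ℂ) • (f.1 + g.1).toLinearMap) fun x hx =>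
      mul_nonneg (by simp) (add_nonneg (f.1.map_nonneg hx) (g.1.map_nonneg hx)), by
    change (1 / 2 : ℂ) * (f.1 1 + g.1 1) = 1
    rw [f.2, g.2]
    norm_num⟩

theorem midState_apply (f g : State B) (b : B) :
    (midState f g).1 b = (1 / 2 : ℂ) * (f.1 b + g.1 b) := rfl

/-- Finitely many nonzero positive elements are detected by a common state. -/
theorem exists_state_forall_ne_zero [Nontrivial B] (T : Finset B)
    (hT : ∀ b ∈ T, 0 ≤ b ∧ b ≠ 0) : ∃ f : State B, ∀ b ∈ T, f.1 b ≠ 0 := by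
  classical
  induction T using Finset.induction_on with
  | empty =>
    obtain ⟨f, -⟩ := exists_state_ne_zero (one_ne_zero (α := B))
    exact ⟨f, by simp⟩
  | insert b T _ ih =>
    obtain ⟨f, hf⟩ := ih fun c hc => hT c (Finset.mem_insert_of_mem hc)
    obtain ⟨g, hg⟩ := exists_state_ne_zero (hT b (Finset.mem_insert_self b T)).2
    refine ⟨midState f g, fun c hc h0 => ?_⟩
    have hc0 := (hT c hc).1
    -- On a positive element both values are nonnegative, so no cancellation occurs: the midpoint
    -- vanishes only where `f` and `g` both do.
    rw [midState_apply, mul_eq_zero_iff_left (by norm_num),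
      add_eq_zero_iff_of_nonneg (f.1.map_nonneg hc0) (g.1.map_nonneg hc0)] at h0
    rcases Finset.mem_insert.1 hc with rfl | hc
    · exact hg h0.2
    · exact hf c hc h0.1

/-! ### Unitaries and the GNS vector. -/

/-- If the unitaries `v` and `w` are separated by the state `f` in the sense that
`f ((w - v)* (w - v)) ≠ 0`, then `f (v* w) ≠ 1`. -/
theorem state_star_mul_ne_one (f : State B) (v w : unitary B)
    (h : f.1 (star ((w : B) - v) * (w - v)) ≠ 0) : f.1 (star (v : B) * w) ≠ 1 := by
  intro hcon
  have h' : f.1 (star (w : B) * v) = 1 := by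
    have := map_star f.1 (star (v : B) * w)
    rwa [star_mul, star_star, hcon, star_one] at this
  -- For unitaries `(w - v)*(w - v) = 2 - w*v - v*w`, and `f` takes the value `1` at both `v*w` and
  -- its adjoint `w*v`.
  apply h
  rw [star_sub, sub_mul, mul_sub, mul_sub, Unitary.star_mul_self_of_mem w.2,
    Unitary.star_mul_self_of_mem v.2, map_sub, map_sub, map_sub, hcon, h', f.2]
  ring

/-- The operator of `a` sends the cyclic vector to the class of `a`, and the GNS inner product of
two classes is defined by `f`. This is what turns matrix coefficients into values of states. -/
theorem gnsVector_inner (f : State B) (a b : B) :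
    ⟪f.1.gnsStarAlgHom a (gnsVector f), f.1.gnsStarAlgHom b (gnsVector f)⟫_ℂ =
      f.1 (star a * b) := by
  change ⟪f.1.gnsNonUnitalStarAlgHom a (f.1.toPreGNS 1 : f.1.PreGNS),
    f.1.gnsNonUnitalStarAlgHom b (f.1.toPreGNS 1 : f.1.PreGNS)⟫_ℂ = _
  rw [PositiveLinearMap.gnsNonUnitalStarAlgHom_apply_coe,
    PositiveLinearMap.gnsNonUnitalStarAlgHom_apply_coe, UniformSpace.Completion.inner_coe,
    PositiveLinearMap.preGNS_inner_def]
  simp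

theorem norm_gnsVector (f : State B) : ‖gnsVector f‖ = 1 := by
  have h := gnsVector_inner f 1 1
  rw [map_one, star_one, one_mul, f.2, one_apply_eq_self, inner_self_eq_norm_sq_to_K] at h
  have h2 : ‖gnsVector f‖ ^ 2 = 1 := Complex.ofReal_injective (by simpa using h)
  exact (pow_eq_one_iff_of_nonneg (norm_nonneg _) two_ne_zero).1 h2

end StateSeparation

/-! ### Products of states on finitely many tensor factors. -/

section Injectivity

variable {I : Type*} {A : I → Type*} [∀ i, CStarAlgebra (A i)] [∀ i, PartialOrder (A i)]
  [∀ i, StarOrderedRing (A i)]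

/-- The products of states separate the linear combinations of elementary tensors of families
which agree outside of a fixed finite set. -/
theorem sum_smul_tprod_eq_zero [∀ i, Nontrivial (A i)] {κ : Type*} (T : Finset κ) (F : Finset I)
    (c : κ → ℂ) (a : κ → ∀ i, A i) (v : ∀ i, A i) (hv : ∀ l ∈ T, ∀ i, i ∉ F → a l i = v i)
    (h : ∀ ρ : ∀ i, State (A i), ∑ l ∈ T, c l * ∏ i ∈ F, (ρ i).1 (a l i) = 0) :
    ∑ l ∈ T, c l • PiTensorProduct.tprod ℂ (a l) = 0 := by
  classical
  induction F using Finset.induction_on generalizing c a v with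
  | empty =>
    -- All the tensors now equal `⊗ v_i`. One family of states must exist for `h` to say anything;
    -- it then says that the coefficients sum to zero.
    choose ρ _ using fun i => exists_state_ne_zero (one_ne_zero (α := A i))
    have h0 : ∑ l ∈ T, c l = 0 := by simpa using h ρ
    have hl : ∀ l ∈ T, c l • PiTensorProduct.tprod ℂ (a l) = c l • PiTensorProduct.tprod ℂ v :=
      fun l hl => by rw [funext fun i => hv l hl i (Finset.notMem_empty i)]
    rw [Finset.sum_congr rfl hl, ← Finset.sum_smul, h0, zero_smul]
  | insert j G hj ih =>
    -- Expand the `j`-th factors in a linear basis; only the finitely many basis vectors in `M`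
    -- occur. The part belonging to `e m` has a constant `j`-th factor, so the induction hypothesis
    -- for `G` applies to it.
    let e := Module.Basis.ofVectorSpace ℂ (A j)
    let M := T.biUnion fun l => (e.repr (a l j)).support
    have hM : ∀ l ∈ T, PiTensorProduct.tprod ℂ (a l) =
        ∑ m ∈ M, e.repr (a l j) m • PiTensorProduct.tprod ℂ (update (a l) j (e m)) := by
      intro l hl
      have hs : a l j = ∑ m ∈ M, e.repr (a l j) m • e m := by
        conv_lhs => rw [← e.linearCombination_repr (a l j)]
        exact Finset.sum_subset (Finset.subset_biUnion_of_mem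
          (fun l => (e.repr (a l j)).support) hl) fun m _ hm => by
            simp [Finsupp.notMem_support_iff.1 hm]
      conv_lhs => rw [← update_eq_self j (a l), hs]
      rw [MultilinearMap.map_update_sum]
      exact Finset.sum_congr rfl fun m _ => MultilinearMap.map_update_smul _ _ _ _ _
    have hswap : ∑ l ∈ T, c l • PiTensorProduct.tprod ℂ (a l) = ∑ m ∈ M, ∑ l ∈ T,
        (c l * e.repr (a l j) m) • PiTensorProduct.tprod ℂ (update (a l) j (e m)) := by
      rw [Finset.sum_comm]
      refine Finset.sum_congr rfl fun l hl => ?_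
      rw [hM l hl, Finset.smul_sum]
      exact Finset.sum_congr rfl fun m _ => smul_smul _ _ _
    rw [hswap]
    refine Finset.sum_eq_zero fun m _ => ih _ _ (update v j (e m)) (fun l hl i hi => ?_) fun ρ => ?_
    · by_cases hij : i = j
      · subst hij
        simp
      · rw [update_of_ne hij, update_of_ne hij]
        exact hv l hl i (by simp [hij, hi])
    -- Freeze the states on `G` and vary only the one at `j`: every state of `A j` kills this
    -- vector, so it is zero. Its `m`-th coordinate is the relation needed for `e m`.
    · have hx : ∑ l ∈ T, (c l * ∏ i ∈ G, (ρ i).1 (a l i)) • a l j = 0 := by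
        by_contra hne
        obtain ⟨f, hf⟩ := exists_state_ne_zero hne
        refine hf ?_
        rw [map_sum, ← h (update ρ j f)]
        refine Finset.sum_congr rfl fun l _ => ?_
        rw [Finset.prod_insert hj, update_self, map_smul, smul_eq_mul]
        have hG : ∏ i ∈ G, (update ρ j f i).1 (a l i) = ∏ i ∈ G, (ρ i).1 (a l i) :=
          Finset.prod_congr rfl fun i hi => by
            rw [update_of_ne (ne_of_mem_of_not_mem hi hj)]
        rw [hG]
        ring
      have hm := congrArg (fun x => e.repr x m) hx
      simp only [map_sum, map_smul, Finsupp.coe_finsetSum, Finset.sum_apply, Finsupp.smul_apply,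
        smul_eq_mul, map_zero, Finsupp.zero_apply] at hm
      rw [← hm]
      refine Finset.sum_congr rfl fun l _ => ?_
      have hG : ∏ i ∈ G, (ρ i).1 (update (a l) j (e m) i) = ∏ i ∈ G, (ρ i).1 (a l i) :=
        Finset.prod_congr rfl fun i hi => by
          rw [update_of_ne (ne_of_mem_of_not_mem hi hj)]
      rw [hG]
      ring

/-! ### Matrix coefficients at tensors of unitaries. -/

/-- The vector `⨂ xᵢ` of `⨂^un H i`, for a family `x` of unit vectors. -/
def unTprod {H : I → Type*} [∀ i, NormedAddCommGroup (H i)] [∀ i, InnerProductSpace ℂ (H i)]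
    (x : ∀ i, H i) (hx : ∀ i, ‖x i‖ = 1) : UnTensor H :=
  ⟨PiTensorProduct.tprod ℂ x, Submodule.subset_span ⟨x, hx, rfl⟩⟩

theorem norm_unitary_gnsVector (ρ : ∀ i, State (A i)) (u : ∀ i, unitary (A i)) (i : I) :
    ‖(ρ i).1.gnsStarAlgHom (u i : A i) (gnsVector (ρ i))‖ = 1 := by
  rw [norm_unitary_apply (H := fun i => (ρ i).1.GNS) (fun i => (ρ i).1.gnsStarAlgHom) (u i),
    norm_gnsVector]

/-- The vector `⨂ π_{ρᵢ}(uᵢ) ξ_{ρᵢ}`, for a family `u` of unitaries. -/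
def unitaryVector (ρ : ∀ i, State (A i)) (u : ∀ i, unitary (A i)) :
    UnTensor fun i => (ρ i).1.GNS :=
  unTprod (fun i => (ρ i).1.gnsStarAlgHom (u i : A i) (gnsVector (ρ i)))
    (norm_unitary_gnsVector ρ u)

theorem unitaryVector_mem_checkSpace (ρ : ∀ i, State (A i)) (u : ∀ i, unitary (A i)) :
    (unitaryVector ρ u : GNSTensor ρ) ∈ checkSpace ρ :=
  Submodule.le_topologicalClosure _
    ⟨unitaryVector ρ u, Submodule.subset_span ⟨_, u, by simp, rfl⟩, rfl⟩

/-- The matrix coefficients of `π_ρ̌`, with respect to the vectors defined by unitaries. -/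
theorem inner_gnsRep_unitaryVector (ρ : ∀ i, State (A i)) (v : ∀ i, unitary (A i))
    (t : utTensor A) (T : Finset (∀ i, unitary (A i))) (c : (∀ i, unitary (A i)) → ℂ)
    (ht : (t : ⨂[ℂ] i, A i) = ∑ u ∈ T, c u • PiTensorProduct.tprod ℂ fun i => (u i : A i)) :
    ⟪(unitaryVector ρ v : GNSTensor ρ), gnsRep ρ t (unitaryVector ρ 1 : GNSTensor ρ)⟫_ℂ =
      ∑ u ∈ T, c u * varphi fun i => (ρ i).1 (star (v i : A i) * u i) := by
  rw [gnsRep, phiRep_coe, UniformSpace.Completion.inner_coe, unTensor_inner_def, unIncl_unAction,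
    ht]
  change phiForm (PiTensorProduct.tprod ℂ _) (tensorAction _ _ (PiTensorProduct.tprod ℂ _)) = _
  simp only [map_sum, LinearMap.sum_apply, map_smul, LinearMap.smul_apply, tensorAction_tprod,
    phiForm_tprod, smul_eq_mul, Pi.one_apply, OneMemClass.coe_one, map_one, one_apply_eq_self,
    gnsVector_inner]

theorem gnsRep_eq_zero_of_checkRep (ρ : ∀ i, State (A i)) {t : utTensor A}
    (h : checkRep ρ t = 0) (v : ∀ i, unitary (A i)) :
    gnsRep ρ t (unitaryVector ρ v : GNSTensor ρ) = 0 := by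
  have h' := DFunLike.congr_fun h ⟨_, unitaryVector_mem_checkSpace ρ v⟩
  rw [zero_apply] at h'
  exact congrArg Subtype.val h'

theorem checkRep_eq_zero_of_gnsRep (ρ : ∀ i, State (A i)) {t : utTensor A}
    (h : gnsRep ρ t = 0) : checkRep ρ t = 0 := by
  refine ContinuousLinearMap.ext fun ζ => Subtype.ext ?_
  have h' : gnsRep ρ t (ζ : GNSTensor ρ) = 0 := by rw [h, zero_apply]
  exact h'

/-! ### Separating the classes of families of unitaries. -/

open Classical in
/-- For finitely many families of unitaries, there is a family of states `τ` such that
`τᵢ (vᵢ* uᵢ) ≠ 1` whenever `uᵢ ≠ vᵢ`. -/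
theorem exists_states_star_mul_ne_one [∀ i, Nontrivial (A i)] (T : Finset (∀ i, unitary (A i)))
    (v : ∀ i, unitary (A i)) :
    ∃ τ : ∀ i, State (A i), ∀ u ∈ T, ∀ i, u i ≠ v i →
      (τ i).1 (star (v i : A i) * u i) ≠ 1 := by
  -- At each index only finitely many elements `(u_i - v_i)*(u_i - v_i)` are involved; they are
  -- positive, and nonzero by the C*-identity, so one state detects them all.
  have h (i : I) := exists_state_forall_ne_zero
    ((T.filter fun u => u i ≠ v i).image fun u => star ((u i : A i) - v i) * ((u i : A i) - v i))
    (by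
      intro b hb
      obtain ⟨u, hu, rfl⟩ := Finset.mem_image.1 hb
      refine ⟨star_mul_self_nonneg _, ?_⟩
      rw [Ne, CStarRing.star_mul_self_eq_zero_iff, sub_eq_zero]
      exact fun h => (Finset.mem_filter.1 hu).2 (Subtype.ext h))
  choose τ hτ using h
  exact ⟨τ, fun u hu i hi => state_star_mul_ne_one _ _ _
    (hτ i _ (Finset.mem_image.2 ⟨u, Finset.mem_filter.2 ⟨hu, hi⟩, rfl⟩))⟩

/-- Two families of unitaries are equivalent if they differ at finitely many indices only. -/
def unitaryClass : Setoid (∀ i, unitary (A i)) where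
  r u v := {i | u i ≠ v i}.Finite
  iseqv :=
    { refl := fun u => by simp
      symm := fun {u v} h => by simpa only [ne_comm] using h
      trans := fun {u v w} h h' => (h.union h').subset fun i hi => by
        by_contra hcon
        simp only [Set.mem_union, Set.mem_ofPred_eq, not_or, not_not] at hcon
        exact hi (hcon.1.trans hcon.2) }

open Classical in
/-- The matrix coefficients `∏ ρᵢ (wᵢ* uᵢ)`, for families of states `ρ` and of unitaries `w`,
separate the linear combinations of the tensors `⨂ uᵢ` of families of unitaries. -/
theorem sum_smul_tprod_unitary_eq_zero [∀ i, Nontrivial (A i)] (T : Finset (∀ i, unitary (A i)))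
    (c : (∀ i, unitary (A i)) → ℂ)
    (h : ∀ (ρ : ∀ i, State (A i)) (w : ∀ i, unitary (A i)),
      ∑ u ∈ T, c u * varphi (fun i => (ρ i).1 (star (w i : A i) * u i)) = 0) :
    ∑ u ∈ T, c u • PiTensorProduct.tprod ℂ (fun i => (u i : A i)) = 0 := by
  refine Finset.sum_cancels_of_partition_cancels unitaryClass fun v hv => ?_
  -- `F` collects the indices where some member of `T` equivalent to `v` differs from `v`.
  -- Inequivalent members contribute nothing, which keeps `F` finite.
  let F : Finset I := T.biUnion fun u : (∀ i, unitary (A i)) =>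
    if hu : {i : I | u i ≠ v i}.Finite then hu.toFinset else ∅
  have hF : ∀ u ∈ T, unitaryClass u v → ∀ i, i ∉ F → u i = v i := by
    intro u hu huv i hi
    by_contra hne
    refine hi (Finset.mem_biUnion.2 ⟨u, hu, ?_⟩)
    have huv' : {i | u i ≠ v i}.Finite := huv
    rw [dif_pos huv']
    simpa using hne
  refine sum_smul_tprod_eq_zero _ F _ (fun (u : ∀ i, unitary (A i)) i => (u i : A i))
    (fun i => (v i : A i)) (fun u hu i hi => ?_) fun ρ => ?_
  · rw [Finset.mem_filter] at hu
    exact congrArg Subtype.val (hF u hu.1 hu.2 i hi)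
  · obtain ⟨τ, hτ⟩ := exists_states_star_mul_ne_one T v
    -- On `F` the coefficient reads off `ρ_i(u_i)`; outside `F` it compares `u_i` with `v_i` through
    -- `τ_i`.
    let σ : ∀ i, State (A i) := fun i => if i ∈ F then ρ i else τ i
    let w : ∀ i, unitary (A i) := fun i => if i ∈ F then 1 else v i
    rw [← h σ w, Finset.sum_filter]
    refine Finset.sum_congr rfl fun u hu => ?_
    split_ifs with huv
    · rw [varphi_eq_prod (F := F)]
      · congr 1
        refine Finset.prod_congr rfl fun i hi => ?_
        simp [σ, w, hi]
      · intro i hi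
        simp only [σ, w, hi, if_false]
        rw [hF u hu huv i hi, Unitary.star_mul_self_of_mem (v i).2, (τ i).2]
    · rw [varphi_eq_zero, mul_zero]
      -- Outside `F`, each index where `u` and `v` differ gives a factor other than `1`. Finitely
      -- many such factors would therefore make `u` equivalent to `v`.
      refine fun hfin => huv (((hfin.union F.finite_toSet).subset fun i hi => ?_))
      by_cases hiF : i ∈ F
      · exact Or.inr hiF
      · refine Or.inl ?_
        simp only [Set.mem_ofPred_eq, σ, w, hiF, if_false]
        exact hτ u hu i hi

/-! ### Injectivity of the direct sums. -/

/-- An element of `⨂^ut A i` vanishing in all the representations `π_ρ̌` is zero. -/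
theorem eq_zero_of_checkRep [∀ i, Nontrivial (A i)] {t : utTensor A}
    (h : ∀ ρ : ∀ i, State (A i), checkRep ρ t = 0) : t = 0 := by
  obtain ⟨c, hc⟩ := Finsupp.mem_span_range_iff_exists_finsupp.1 (mem_span_unitary t.2)
  have ht : (t : ⨂[ℂ] i, A i) =
    ∑ u ∈ c.support, c u • PiTensorProduct.tprod ℂ fun i => (u i : A i) := hc.symm
  refine Subtype.ext (ht.trans (sum_smul_tprod_unitary_eq_zero _ _ fun ρ w => ?_))
  rw [← inner_gnsRep_unitaryVector ρ w t c.support c ht, gnsRep_eq_zero_of_checkRep ρ (h ρ),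
    inner_zero_right]

/-- A direct sum of *-representations is injective if they have no common nonzero zero. -/
theorem directSumRep_injective {B : Type*} [Ring B] [StarRing B] [Algebra ℂ B] {J : Type*}
    {K : J → Type*} [∀ j, NormedAddCommGroup (K j)]
    [∀ j, InnerProductSpace ℂ (K j)] [∀ j, CompleteSpace (K j)]
    (π : ∀ j, B →⋆ₐ[ℂ] (K j →L[ℂ] K j))
    (hπ : ∀ b, ∃ C : ℝ, 0 ≤ C ∧ ∀ j, ‖π j b‖ ≤ C) (h : ∀ b, (∀ j, π j b = 0) → b = 0) :
    Injective (directSumRep π hπ) := by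
  classical
  rw [injective_iff_map_eq_zero]
  refine fun b hb => h b fun j => ?_
  ext ζ
  -- Testing on vectors supported at the single index `j` recovers `π j b`.
  have := directSumRep_apply π hπ b (lp.single 2 j ζ) j
  rw [hb] at this
  simpa using this.symm

end Injectivity

/-- The unit is `⊗ 1`, and a zero algebra `A i` makes one of its factors `0`; hence `1 = 0`. -/
theorem utTensor_subsingleton {I : Type*} {A : I → Type*} [∀ i, CStarAlgebra (A i)] {i : I}
    [Subsingleton (A i)] : Subsingleton (utTensor A) := by
  have h : (1 : ⨂[ℂ] i, A i) = 0 := by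
    rw [PiTensorProduct.one_def]
    exact MultilinearMap.map_coord_zero _ i (Subsingleton.elim _ _)
  refine ⟨fun s t => Subtype.ext ?_⟩
  rw [← one_mul (s : ⨂[ℂ] i, A i), ← one_mul (t : ⨂[ℂ] i, A i), h, zero_mul, zero_mul]

theorem checkSumRep_injective {I : Type*} {A : I → Type*} [∀ i, CStarAlgebra (A i)]
    [∀ i, PartialOrder (A i)] [∀ i, StarOrderedRing (A i)] [∀ i, Nontrivial (A i)] :
    Injective (checkSumRep A) :=
  directSumRep_injective (B := utTensor A) (J := ∀ i, State (A i))
    (K := fun ρ => checkSpace ρ) checkRep checkRep_bound fun _ ht => eq_zero_of_checkRep ht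

theorem gnsSumRep_injective {I : Type*} {A : I → Type*} [∀ i, CStarAlgebra (A i)]
    [∀ i, PartialOrder (A i)] [∀ i, StarOrderedRing (A i)] [∀ i, Nontrivial (A i)] :
    Injective (gnsSumRep A) :=
  directSumRep_injective (B := utTensor A) (J := ∀ i, State (A i))
    (K := fun ρ => GNSTensor ρ) gnsRep gnsRep_bound fun _ ht =>
      eq_zero_of_checkRep fun ρ => checkRep_eq_zero_of_gnsRep ρ (ht ρ)

end InfTensor

end

theorem mainTheorem10 {I : Type*} [Infinite I] (A : I → Type*) [∀ i, CStarAlgebra (A i)]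
    [∀ i, PartialOrder (A i)] [∀ i, StarOrderedRing (A i)] :
    Function.Injective (InfTensor.checkSumRep A) ∧ Function.Injective (InfTensor.gnsSumRep A) := by
  -- A zero algebra has no states, so a single zero factor leaves no families `ρ` to sum over. The
  -- tensor algebra is then zero too, and injectivity is trivial.
  by_cases hA : ∃ i, Subsingleton (A i)
  · obtain ⟨i, hi⟩ := hA
    have := InfTensor.utTensor_subsingleton (A := A) (i := i)
    exact ⟨Function.injective_of_subsingleton _, Function.injective_of_subsingleton _⟩
  · have (i : I) : Nontrivial (A i) := by
      rw [← not_subsingleton_iff_nontrivial]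
      exact fun h => hA ⟨i, h⟩
    exact ⟨InfTensor.checkSumRep_injective, InfTensor.gnsSumRep_injective⟩
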